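/- **Model.** Consider a stationary Markov decision model with state space $\mathbb{R}$, Borel action space $A$, measurable set $D\subseteq\mathbb{R}\times A$ of admissible pairs with sections $D(x)$, containing the graph of a measurable map $\mathbb{R}\to A$, i.i.d. disturbances $Z_1,Z_2,\dots$ (with generic copy $Z$) in a measurable space $\mathcal{Z}$, measurable transition function $T:D\times\mathcal{Z}\to\mathbb{R}$, measurable one-stage cost $c:D\times\mathbb{R}\to[0,\infty)$, zero terminal cost and discount factor $\beta>0$. Let $g:\mathbb{R}\to\mathbb{R}$ be increasing (i.e. nondecreasing) and convex with $g\ge 0$ on $[0,\infty)$, and put $g(\infty)=\lim_{r\to\infty}g(r)$. The extended state space is $\widehat E=\mathbb{R}\times[0,\infty)\times(0,\infty)$, with transitions $\widehat T(x,s,t,a,z)=\big(T(x,a,z),\,s+t\,c(x,a,T(x,a,z)),\,\beta t\big)$. A feasible history at time $n$ is $h_n=(y_0,a_0,y_1,\dots,a_{n-1},y_n)$ with $y_k=(x_k,s_k,t_k)\in\widehat E$ and $a_k\in D(x_k)$. A policy is a sequence of measurable maps $d_n$ from feasible histories to $A$ with $d_n(h_n)\in D(x_n)$; it is Markov if each $d_n$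 depends on $y_n$ only. For a horizon $N$, $0\le n\le N$, a policy $\pi=(d_0,d_1,\dots)$ and a feasible history $h_n$, let $$V_{n\pi}(h_n)=\mathbb{E}\Big[g\Big(s_n+t_n\sum_{k=n}^{N-1}\beta^{k-n}c\big(X_k,d_k(H_k),X_{k+1}\big)\Big)\Big],\qquad V_n=\inf_\pi V_{n\pi},$$ where $(H_k)_{k\ge n}$ is the random history that continues $h_n$ under $\pi$ and $X_k$ is the state at time $k$. For Markov $\pi$ this depends on $y_n$ only and is written $J_{n\pi}(y_n)$, and $J_n=\inf J_{n\pi}$ over Markov policies. For the infinite horizon and Markov $\pi$ let $J_{\infty\pi}(x,s,t)=\mathbb{E}\big[g\big(s+t\sum_{k=0}^\infty\beta^k c(X_k,d_k,X_{k+1})\big)\big]$ and $J_\infty=\inf J_{\infty\pi}$ over Markov policies. All values are in $[0,\infty]$. For measurable $v:\widehat E\to[0,\infty]$ and a Markov decision rule $d$ put $Lv(y,a)=\mathbb{E}[v(\widehat T(y,a,Z))]$, $\mathcal{T}_dv(y)=Lv(y,d(y))$ and $\mathcal{T}v(x,s,t)=\inf_{a\in D(x)}Lv(x,s,t,a)$.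 Let $\mathbb{M}$ be the set of lower semicontinuous $v:\widehat E\to[0,\infty]$ such that $v(x,\cdot,\cdot)$ is increasing for every $x$ and $v(x,s,t)\ge g(s)$, and let $\mathbb{M}'\subseteq\mathbb{M}$ be the set of those that are increasing in all variables. **Assumptions.** The sets $D(x)$ are compact and decreasing in $x$ ($D(x)\supseteq D(y)$ for $x\le y$), and $x\mapsto D(x)$ is upper semicontinuous (if $x_k\to x$ and $a_k\in D(x_k)$, then $(a_k)$ has an accumulation point in $D(x)$). For every $z$, both $T(x,a,z)$ and $c(x,a,T(x,a,z))$ are lower semicontinuous in $(x,a)$ on $D$ and increasing in $x$. **Proposition 6.2.** Under these assumptions: 1. *(Finite horizon.)* For every $N$ and $n\le N$: $V_n(h_n)=J_n(x_n,s_n,t_n)$ for all feasible histories $h_n$, and $J_n\in\mathbb{M}$ is increasing in all variables. Moreover $J_N(x,s,t)=g(s)$, and $J_n=\mathcal{T}J_{n+1}$ for $n<N$. For $n<N$ there are Markov decision rules $d_n^*$ with $\mathcal{T}_{d_n^*}J_{n+1}=\mathcal{T}J_{n+1}$, and for every sequence of such minimizers the policy $\pi^*=(d_0^*,\dots,d_{N-1}^*)$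 is optimal: $V_{n\pi^*}=V_n$ on feasible histories and $J_{n\pi^*}=J_n$, for all $n\le N$. If $g$ is Lipschitz and for every $x$ some policy has integrable total discounted cost over $N$ stages when started in $(x,0,1)$, then every $J_n$ is real-valued. 2. *(Infinite horizon.)* $J_\infty$ is the smallest fixed point of $\mathcal{T}$ in $\mathbb{M}$, also the smallest one in $\mathbb{M}'$; it is increasing in all variables, and it is the pointwise limit for $N\to\infty$ of the value functions $J_0$ of horizon $N$, which are increasing in $N$. There is a Markov decision rule $d^*$ with $\mathcal{T}_{d^*}J_\infty=\mathcal{T}J_\infty$, and for each such $d^*$ the stationary policy $\pi^*=(d^*,d^*,\dots)$ is optimal, $J_{\infty\pi^*}=J_\infty$. If $g$ is Lipschitz and for every $x$ some policy has integrable total discounted cost over the infinite horizon when started in $(x,0,1)$, then $J_\infty$ is real-valued. 3. *(The set $\mathbb{M}'$.)* For every $v\in\mathbb{M}'$ one has $\mathcal{T}v\in\mathbb{M}'$, and there is a Markov decision rule $d$ with $\mathcal{T}_dv=\mathcal{T}v$. -/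

import Mathlib

open MeasureTheory ProbabilityTheory Filter Topology
open scoped NNReal ENNReal

noncomputable section

namespace RiskMDP

/-- The extended state space `ℝ × [0,∞) × (0,∞)`: a point `(x, s, t)` consists of the state `x`,
the cost `s` accumulated so far and the current discounting `t`. -/
abbrev XState : Type := ℝ × ℝ≥0 × {t : ℝ≥0 // 0 < t}

/-- A stationary Markov decision model with state space `ℝ`, action space `A`, disturbance space
`𝒵` and no terminal cost. The transition function and the one-stage cost only matter on the
measurable set `D` of admissible state-action pairs. They are total functions here; this is no
restriction, as a measurable function on `D × 𝒵` or `D × ℝ` can be continued by `0`. -/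
structure Model (A 𝒵 : Type*) [MeasurableSpace A] [MeasurableSpace 𝒵] where
  /-- admissible state-action combinations -/
  D : Set (ℝ × A)
  measurableSet_D : MeasurableSet D
  /-- `D` contains the graph of a measurable mapping -/
  exists_selector : ∃ f : ℝ → A, Measurable f ∧ ∀ x, (x, f x) ∈ D
  /-- transition function `T(x, a, z)` -/
  T : ℝ → A → 𝒵 → ℝ
  measurable_T : Measurable fun p : ℝ × A × 𝒵 => T p.1 p.2.1 p.2.2
  /-- one-stage cost `c(x, a, x')` -/
  c : ℝ → A → ℝ → ℝ≥0
  measurable_c : Measurable fun p : ℝ × A × ℝ => c p.1 p.2.1 p.2.2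
  /-- discount factor -/
  β : {b : ℝ≥0 // 0 < b}

/-- The monotonicity, semicontinuity and compactness assumptions. -/
structure Model.IsMonotone {A 𝒵 : Type*} [MeasurableSpace A] [MeasurableSpace 𝒵]
    [TopologicalSpace A] (m : Model A 𝒵) : Prop where
  /-- the sets `D(x)` are compact -/
  compact_D : ∀ x, IsCompact {a | (x, a) ∈ m.D}
  /-- `x ↦ D(x)` is upper semicontinuous -/
  usc_D : ∀ (xs : ℕ → ℝ) (x : ℝ) (as : ℕ → A), Tendsto xs atTop (𝓝 x) →
    (∀ k, (xs k, as k) ∈ m.D) → ∃ a, (x, a) ∈ m.D ∧ MapClusterPt a atTop as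
  /-- `x ↦ D(x)` is decreasing -/
  antitone_D : ∀ x y a, x ≤ y → (y, a) ∈ m.D → (x, a) ∈ m.D
  /-- `T` is lower semicontinuous in `(x, a)` -/
  lsc_T : ∀ z, LowerSemicontinuousOn (fun p : ℝ × A => m.T p.1 p.2 z) m.D
  /-- `T` is increasing in `x` -/
  mono_T : ∀ z x y a, (x, a) ∈ m.D → (y, a) ∈ m.D → x ≤ y → m.T x a z ≤ m.T y a z
  /-- `c(x, a, T(x, a, z))` is lower semicontinuous in `(x, a)` -/
  lsc_c : ∀ z, LowerSemicontinuousOn (fun p : ℝ × A => m.c p.1 p.2 (m.T p.1 p.2 z)) m.D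
  /-- `c(x, a, T(x, a, z))` is increasing in `x` -/
  mono_c : ∀ z x y a, (x, a) ∈ m.D → (y, a) ∈ m.D → x ≤ y →
    m.c x a (m.T x a z) ≤ m.c y a (m.T y a z)

/-- Histories `(y₀, a₀, y₁, …, a_{n-1}, y_n)` up to time `n` in the extended state space. -/
abbrev Hist (A : Type*) (n : ℕ) : Type _ := (Fin (n + 1) → XState) × (Fin n → A)

/-- The last state of a history. -/
def Hist.last {A : Type*} {n : ℕ} (h : Hist A n) : XState := h.1 (Fin.last n)

/-- Append an action and the next state to a history. -/
def Hist.snoc {A : Type*} {n : ℕ} (h : Hist A n) (a : A) (y : XState) : Hist A (n + 1) :=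
  (Fin.snoc (α := fun _ => XState) h.1 y, Fin.snoc (α := fun _ => A) h.2 a)

/-- The history at time `0` in state `y`. -/
def Hist.init (A : Type*) (y : XState) : Hist A 0 := (fun _ => y, Fin.elim0)

/-- A nondecreasing `g` as a function on `[0,∞]`, with `g(∞) = sup g = lim_{r → ∞} g(r)`. -/
def extend (g : ℝ → ℝ) (y : ℝ≥0∞) : ℝ≥0∞ :=
  if y = ∞ then ⨆ r : ℝ≥0, ENNReal.ofReal (g r) else ENNReal.ofReal (g y.toReal)

/-- The set `𝕄` of lower semicontinuous functions `v` on the extended state space such that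
`v(x,·,·)` is increasing for all `x` and `v(x,s,t) ≥ g(s)`. The value `+∞` is allowed. -/
def valueFunctions (g : ℝ → ℝ) : Set (XState → ℝ≥0∞) :=
  {v | LowerSemicontinuous v ∧
    (∀ x, Monotone fun p : ℝ≥0 × {t : ℝ≥0 // 0 < t} => v (x, p)) ∧
    ∀ y, ENNReal.ofReal (g y.2.1) ≤ v y}

/-- The smaller set `𝕄'` of lower semicontinuous functions `v` on the extended state space that
are increasing in all variables and satisfy `v(x,s,t) ≥ g(s)`. -/
def monotoneValueFunctions (g : ℝ → ℝ) : Set (XState → ℝ≥0∞) :=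
  {v | LowerSemicontinuous v ∧ Monotone v ∧ ∀ y, ENNReal.ofReal (g y.2.1) ≤ v y}

namespace Model

variable {A 𝒵 : Type*} [MeasurableSpace A] [MeasurableSpace 𝒵]

/-- The transition function on the extended state space. -/
def step (m : Model A 𝒵) (y : XState) (a : A) (z : 𝒵) : XState :=
  (m.T y.1 a z, y.2.1 + y.2.2.1 * m.c y.1 a (m.T y.1 a z), m.β * y.2.2)

/-- A history is feasible if all its actions were admissible. -/
def Feasible (m : Model A 𝒵) {n : ℕ} (h : Hist A n) : Prop :=
  ∀ k : Fin n, ((h.1 k.castSucc).1, h.2 k) ∈ m.D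

/-- History-dependent policies in the extended model. For a finite horizon `N` only the rules at
times `n < N` matter, and only their values on feasible histories do. -/
structure Policy (m : Model A 𝒵) where
  rule : ∀ n, Hist A n → A
  measurable_rule : ∀ n, Measurable (rule n)
  mem_D : ∀ n (h : Hist A n), m.Feasible h → (h.last.1, rule n h) ∈ m.D

/-- Markov decision rules in the extended model. -/
structure MarkovRule (m : Model A 𝒵) where
  rule : XState → A
  measurable_rule : Measurable rule
  mem_D : ∀ y : XState, (y.1, rule y) ∈ m.D

/-- Markov policies in the extended model. -/
abbrev MarkovPolicy (m : Model A 𝒵) : Type _ := ℕ → m.MarkovRule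

/-- A Markov policy is in particular a history-dependent policy. -/
def MarkovPolicy.toPolicy {m : Model A 𝒵} (π : m.MarkovPolicy) : m.Policy where
  rule n h := (π n).rule h.last
  measurable_rule n :=
    (π n).measurable_rule.comp ((measurable_pi_apply (Fin.last n)).comp measurable_fst)
  mem_D n h _ := (π n).mem_D h.last

/-- The history at time `n + k` under `π`, given the history `h` at time `n`. The disturbance
`z j` drives the transition from time `j` to time `j + 1`. -/
def history (m : Model A 𝒵) (π : m.Policy) (z : ℕ → 𝒵) (n : ℕ) (h : Hist A n) :
    ∀ k, Hist A (n + k)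
  | 0 => h
  | k + 1 =>
    let H := m.history π z n h k
    H.snoc (π.rule (n + k) H) (m.step H.last (π.rule (n + k) H) (z (n + k)))

/-- The undiscounted cost of the stage from time `n + k` to `n + k + 1` under `π`, given the
history `h` at time `n`. -/
def stageCost (m : Model A 𝒵) (π : m.Policy) (z : ℕ → 𝒵) (n : ℕ) (h : Hist A n) (k : ℕ) : ℝ≥0 :=
  let H := m.history π z n h k
  m.c H.last.1 (π.rule (n + k) H) (m.history π z n h (k + 1)).last.1

/-- The extended state at time `n + k` under the Markov policy `π`, given state `y` at time `n`. -/
def markovState (m : Model A 𝒵) (π : m.MarkovPolicy) (z : ℕ → 𝒵) (n : ℕ) (y : XState) :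
    ℕ → XState
  | 0 => y
  | k + 1 =>
    let Y := m.markovState π z n y k
    m.step Y ((π (n + k)).rule Y) (z (n + k))

/-- The undiscounted cost of the stage from time `n + k` to `n + k + 1` under the Markov policy
`π`, given state `y` at time `n`. -/
def markovStageCost (m : Model A 𝒵) (π : m.MarkovPolicy) (z : ℕ → 𝒵) (n : ℕ) (y : XState)
    (k : ℕ) : ℝ≥0 :=
  let Y := m.markovState π z n y k
  m.c Y.1 ((π (n + k)).rule Y) (m.markovState π z n y (k + 1)).1

variable {Ω : Type*} [MeasurableSpace Ω]

/-- The value `V_{nπ}(h)` of a history-dependent policy at time `n` for the horizon `N`: the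
conditional expectation of the disutility of the total cost given the history `h` at time `n`. As
the disturbances are independent, it is the expectation over the trajectories that continue `h`. -/
def policyValue (m : Model A 𝒵) (g : ℝ → ℝ) (P : Measure Ω) (Z : ℕ → Ω → 𝒵) (N n : ℕ)
    (π : m.Policy) (h : Hist A n) : ℝ≥0∞ :=
  ∫⁻ ω, ENNReal.ofReal (g ((h.last.2.1 + h.last.2.2.1 *
    ∑ k ∈ Finset.range (N - n), m.β.1 ^ k * m.stageCost π (fun j => Z j ω) n h k : ℝ≥0) : ℝ)) ∂P

/-- The value function `V_n` for the horizon `N`. -/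
def value (m : Model A 𝒵) (g : ℝ → ℝ) (P : Measure Ω) (Z : ℕ → Ω → 𝒵) (N n : ℕ)
    (h : Hist A n) : ℝ≥0∞ :=
  ⨅ π : m.Policy, m.policyValue g P Z N n π h

/-- The value `J_{nπ}(y)` of a Markov policy at time `n` for the horizon `N`. -/
def markovPolicyValue (m : Model A 𝒵) (g : ℝ → ℝ) (P : Measure Ω) (Z : ℕ → Ω → 𝒵) (N n : ℕ)
    (π : m.MarkovPolicy) (y : XState) : ℝ≥0∞ :=
  ∫⁻ ω, ENNReal.ofReal (g ((y.2.1 + y.2.2.1 *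
    ∑ k ∈ Finset.range (N - n), m.β.1 ^ k * m.markovStageCost π (fun j => Z j ω) n y k : ℝ≥0) : ℝ))
    ∂P

/-- The Markov value function `J_n` for the horizon `N`. -/
def markovValue (m : Model A 𝒵) (g : ℝ → ℝ) (P : Measure Ω) (Z : ℕ → Ω → 𝒵) (N n : ℕ)
    (y : XState) : ℝ≥0∞ :=
  ⨅ π : m.MarkovPolicy, m.markovPolicyValue g P Z N n π y

/-- The value `J_{∞π}(y)` of a Markov policy under the infinite horizon; the total cost may be
infinite. -/
def infPolicyValue (m : Model A 𝒵) (g : ℝ → ℝ) (P : Measure Ω) (Z : ℕ → Ω → 𝒵)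
    (π : m.MarkovPolicy) (y : XState) : ℝ≥0∞ :=
  ∫⁻ ω, extend g ((y.2.1 : ℝ≥0∞) + (y.2.2.1 : ℝ≥0∞) *
    ∑' k, ((m.β.1 ^ k * m.markovStageCost π (fun j => Z j ω) 0 y k : ℝ≥0) : ℝ≥0∞)) ∂P

/-- The infinite horizon value function `J_∞`. -/
def infValue (m : Model A 𝒵) (g : ℝ → ℝ) (P : Measure Ω) (Z : ℕ → Ω → 𝒵) (y : XState) : ℝ≥0∞ :=
  ⨅ π : m.MarkovPolicy, m.infPolicyValue g P Z π y

/-- The expected total discounted cost over `N` stages under `π` from the initial state `x`. -/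
def expectedCost (m : Model A 𝒵) (P : Measure Ω) (Z : ℕ → Ω → 𝒵) (N : ℕ) (π : m.Policy)
    (x : ℝ) : ℝ≥0∞ :=
  ∫⁻ ω, ((∑ k ∈ Finset.range N, m.β.1 ^ k *
    m.stageCost π (fun j => Z j ω) 0 (Hist.init A (x, 0, ⟨1, one_pos⟩)) k : ℝ≥0) : ℝ≥0∞) ∂P

/-- The expected total discounted cost over the infinite horizon under `π` from the initial state
`x`. -/
def infExpectedCost (m : Model A 𝒵) (P : Measure Ω) (Z : ℕ → Ω → 𝒵) (π : m.Policy)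
    (x : ℝ) : ℝ≥0∞ :=
  ∫⁻ ω, ∑' k, ((m.β.1 ^ k *
    m.stageCost π (fun j => Z j ω) 0 (Hist.init A (x, 0, ⟨1, one_pos⟩)) k : ℝ≥0) : ℝ≥0∞) ∂P

/-- The operator `L v(y, a) = E[v(T̂(y, a, Z))]`, with `W` a representative of the disturbances. -/
def opL (m : Model A 𝒵) (P : Measure Ω) (W : Ω → 𝒵) (v : XState → ℝ≥0∞) (y : XState) (a : A) :
    ℝ≥0∞ :=
  ∫⁻ ω, v (m.step y a (W ω)) ∂P

/-- The operator `𝒯_d v(y) = L v(y, d(y))`. -/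
def opRule (m : Model A 𝒵) (P : Measure Ω) (W : Ω → 𝒵) (d : m.MarkovRule) (v : XState → ℝ≥0∞)
    (y : XState) : ℝ≥0∞ :=
  m.opL P W v y (d.rule y)

/-- The Bellman operator `𝒯 v(x, s, t) = inf_{a ∈ D(x)} L v(x, s, t, a)`. -/
def bellman (m : Model A 𝒵) (P : Measure Ω) (W : Ω → 𝒵) (v : XState → ℝ≥0∞) (y : XState) :
    ℝ≥0∞ :=
  ⨅ a ∈ {a | (y.1, a) ∈ m.D}, m.opL P W v y a

end Model

end RiskMDP

end

/-! The extended state carries the accumulated cost `s` and the current discount `t`, so the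
disutility of the total cost is `g` of the `s`-component of the final state (`policyValue_eq`). The
problem becomes an ordinary Markov decision problem with terminal cost `g s` and no running cost.
Its value with `k` stages to go is the iterate `iterValue k` of the Bellman operator, started at `g
s`. For every policy, the expectation of the iterate for the remaining stages, taken at the current
state, is nondecreasing in time (`le_lintegral_history`); it is constant when the actions are
minimizers (`lintegral_history_eq`). Comparing first and last time gives the lower bound over all
histories and its attainment by Markov policies.

This needs the Bellman operator to preserve lower semicontinuity and monotonicity, and measurable
minimizers to exist. As `T` and `c` are only lower semicontinuous, `v` composed with a transition is
lower semicontinuous because `v` is also increasing (`lsc_comp_step`). Fatou's lemma carries this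
through the expectation, compactness of `D(x)` through the infimum. Minimizers form a measurable
compact-valued correspondence, which has a measurable selection.

For the infinite horizon, costs are nonnegative, so the iterates increase and each policy's value is
the supremum of its finite-horizon values. A compactness argument exchanges this supremum with the
infimum over actions (`bellman_iSup_iterValue`), so the limit is a fixed point. It is the least one
because every fixed point above `g s` dominates all iterates. Finiteness follows by comparing `g s`
with `g 0 + K s`, that is, with the risk-neutral problem. -/

/-! ### Measurable selection from compact-valued correspondences. -/

/-- The points of `S` that are closest to `q`. -/
def nearestPoints {A : Type*} [MetricSpace A] (S : Set A) (q : A) : Set A :=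
  {a ∈ S | ∀ b ∈ S, dist a q ≤ dist b q}

/-- A nonempty compact-valued map whose lower inverse images of closed sets are measurable. -/
structure IsMeasurableCorrespondence {X A : Type*} [MeasurableSpace X] [TopologicalSpace A]
    (K : X → Set A) : Prop where
  compact : ∀ x, IsCompact (K x)
  nonempty : ∀ x, (K x).Nonempty
  measurable : ∀ F, IsClosed F → MeasurableSet {x | (K x ∩ F).Nonempty}

namespace IsMeasurableCorrespondence

variable {X A : Type*} [MeasurableSpace X]

/-- By compactness, some nearest point lies in `F` exactly when `K x` meets `F` and the minimal
distance over `K x ∩ F` does not exceed that over `K x`. Comparing the two minima at rational radii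
makes this a countable condition. -/
theorem nearestPoints [MetricSpace A] {K : X → Set A} (hK : IsMeasurableCorrespondence K) (q : A) :
    IsMeasurableCorrespondence fun x => nearestPoints (K x) q where
  compact x := by
    have : _root_.nearestPoints (K x) q = K x ∩ ⋂ b ∈ K x, {a | dist a q ≤ dist b q} := by
      ext a
      simp [_root_.nearestPoints]
    rw [this]
    exact (hK.compact x).inter_right (isClosed_biInter fun b _ =>
      isClosed_le (by fun_prop) continuous_const)
  nonempty x := by
    obtain ⟨a, ha, hmin⟩ := (hK.compact x).exists_isMinOn (hK.nonempty x)
      (f := fun a => dist a q) (by fun_prop)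
    exact ⟨a, ha, fun b hb => hmin hb⟩
  measurable F hF := by
    have : {x | (_root_.nearestPoints (K x) q ∩ F).Nonempty} = {x | (K x ∩ F).Nonempty} ∩
        ⋂ r : ℚ, ({x | (K x ∩ Metric.closedBall q r).Nonempty}ᶜ ∪
          {x | (K x ∩ (F ∩ Metric.closedBall q r)).Nonempty}) := by
      ext x
      simp only [Set.mem_ofPred_eq, Set.mem_inter_iff, Set.mem_iInter, Set.mem_union,
        Set.mem_compl_iff]
      constructor
      · rintro ⟨a, ⟨haK, hmin⟩, haF⟩
        refine ⟨⟨a, haK, haF⟩, fun r => or_iff_not_imp_left.2 fun h => ?_⟩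
        obtain ⟨b, hbK, hb⟩ := not_not.1 h
        exact ⟨a, haK, haF, (hmin b hbK).trans hb⟩
      · rintro ⟨hne, h⟩
        obtain ⟨a, ha, hmin⟩ := ((hK.compact x).inter_right hF).exists_isMinOn hne
          (f := fun a => dist a q) (by fun_prop)
        refine ⟨a, ⟨ha.1, fun b hb => ?_⟩, ha.2⟩
        by_contra! hlt
        obtain ⟨r, hr1, hr2⟩ := exists_rat_btwn hlt
        rcases h r with h | ⟨c, hcK, hcF, hc⟩
        · exact h ⟨b, hb, hr1.le⟩
        · exact absurd (hmin ⟨hcK, hcF⟩) (not_le.2 (lt_of_le_of_lt hc hr2))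
    rw [this]
    exact (hK.measurable F hF).inter (MeasurableSet.iInter fun r =>
      (hK.measurable _ Metric.isClosed_closedBall).compl.union
        (hK.measurable _ (hF.inter Metric.isClosed_closedBall)))

/-- Lexicographic refinement of a correspondence by distances to the points `q n`. -/
def refine [MetricSpace A] (K : X → Set A) (q : ℕ → A) : ℕ → X → Set A
  | 0 => K
  | n + 1 => fun x => _root_.nearestPoints (refine K q n x) (q n)

/-- Minimizing the distances to a dense sequence one after another shrinks `K x` through nested
compact sets to a single point, which is the selection. By compactness it lies in a closed `F` iff
every refinement meets `F`, a countable intersection of measurable conditions. -/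
theorem exists_measurable_selection_of_metric [MetricSpace A] [SecondCountableTopology A]
    [MeasurableSpace A] [BorelSpace A] {K : X → Set A} (hK : IsMeasurableCorrespondence K) :
    ∃ f : X → A, Measurable f ∧ ∀ x, f x ∈ K x := by
  rcases isEmpty_or_nonempty X with hX | ⟨⟨x₀⟩⟩
  · exact ⟨isEmptyElim, measurable_of_empty _, isEmptyElim⟩
  have : Nonempty A := (hK.nonempty x₀).to_type
  set q := TopologicalSpace.denseSeq A with hq
  have hR : ∀ n, IsMeasurableCorrespondence (refine K q n) := by
    intro n
    induction n with
    | zero => exact hK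
    | succ n ih => exact ih.nearestPoints (q n)
  have hsub : ∀ n x, refine K q (n + 1) x ⊆ refine K q n x := fun n x a ha => ha.1
  have hne : ∀ F, IsClosed F → ∀ x, (∀ n, (refine K q n x ∩ F).Nonempty) →
      (⋂ n, refine K q n x ∩ F).Nonempty := fun F hF x h =>
    IsCompact.nonempty_iInter_of_sequence_nonempty_isCompact_isClosed _
      (fun n => Set.inter_subset_inter_left _ (hsub n x)) h
      (((hR 0).compact x).inter_right hF) fun n => (((hR n).compact x).isClosed).inter hF
  have hex : ∀ x, ∃ a, ∀ n, a ∈ refine K q n x := by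
    intro x
    obtain ⟨a, ha⟩ := hne Set.univ isClosed_univ x (by simpa using fun n => (hR n).nonempty x)
    exact ⟨a, fun n => (Set.mem_iInter.1 ha n).1⟩
  have huniq : ∀ x a b, (∀ n, a ∈ refine K q n x) → (∀ n, b ∈ refine K q n x) → a = b := by
    intro x a b ha hb
    -- Two survivors have equal distances to all points of a dense sequence, hence to every point,
    -- in particular to `b`.
    have h1 : (fun y => dist a y) = fun y => dist b y := by
      refine (TopologicalSpace.denseRange_denseSeq A).equalizer (by fun_prop) (by fun_prop) ?_
      funext n
      exact le_antisymm ((ha (n + 1)).2 b (hb n)) ((hb (n + 1)).2 a (ha n))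
    have h2 := congrFun h1 b
    simpa using h2
  choose f hf using hex
  refine ⟨f, measurable_of_isClosed fun F hF => ?_, fun x => hf x 0⟩
  have : f ⁻¹' F = ⋂ n, {x | (refine K q n x ∩ F).Nonempty} := by
    ext x
    simp only [Set.mem_preimage, Set.mem_iInter, Set.mem_ofPred_eq]
    refine ⟨fun h n => ⟨f x, hf x n, h⟩, fun h => ?_⟩
    obtain ⟨a, ha⟩ := hne F hF x h
    rw [Set.mem_iInter] at ha
    rw [huniq x (f x) a (hf x) fun n => (ha n).1]
    exact (ha 0).2
  rw [this]
  exact MeasurableSet.iInter fun n => (hR n).measurable F hF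

theorem exists_measurable_selection [TopologicalSpace A] [TopologicalSpace.MetrizableSpace A]
    [SecondCountableTopology A] [MeasurableSpace A] [BorelSpace A] {K : X → Set A}
    (hK : IsMeasurableCorrespondence K) : ∃ f : X → A, Measurable f ∧ ∀ x, f x ∈ K x := by
  let _ := TopologicalSpace.metrizableSpaceMetric A
  exact exists_measurable_selection_of_metric hK

end IsMeasurableCorrespondence

/-! ### Lower semicontinuity under truncation and integration. -/

/-- Lower semicontinuity is the lower half of convergence; truncating at the limit value forces the
upper half. -/
theorem LowerSemicontinuousWithinAt.tendsto_min {X R : Type*} [TopologicalSpace X] [LinearOrder R]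
    [TopologicalSpace R] [OrderTopology R] {f : X → R} {s : Set X} {x : X}
    (h : LowerSemicontinuousWithinAt f s x) :
    Tendsto (fun x' => min (f x') (f x)) (𝓝[s] x) (𝓝 (f x)) := by
  refine tendsto_order.2 ⟨fun a ha => ?_, fun a ha => ?_⟩
  · filter_upwards [h a ha] with x' hx'
    exact lt_min hx' ha
  · exact Eventually.of_forall fun x' => (min_le_right _ _).trans_lt ha

/-- Fatou's lemma along the neighbourhood filter, which first countability makes countably
generated. -/
theorem LowerSemicontinuousOn.lintegral {X Ω : Type*} [TopologicalSpace X]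
    [FirstCountableTopology X] [MeasurableSpace Ω] {P : Measure Ω} {s : Set X}
    {f : X → Ω → ℝ≥0∞} (hf : ∀ x, Measurable (f x))
    (h : ∀ ω, LowerSemicontinuousOn (fun x => f x ω) s) :
    LowerSemicontinuousOn (fun x => ∫⁻ ω, f x ω ∂P) s := by
  rw [lowerSemicontinuousOn_iff_le_liminf]
  intro x hx
  exact (lintegral_mono fun ω => (h ω).le_liminf x hx).trans (lintegral_liminf_le hf)

/-! ### The one-step operators: semicontinuity, monotonicity, minimizers. -/

namespace RiskMDP.Model

variable {A 𝒵 Ω : Type*} [MeasurableSpace A] [MeasurableSpace 𝒵] [MeasurableSpace Ω]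

theorem measurable_step (m : Model A 𝒵) :
    Measurable fun p : XState × A × 𝒵 => m.step p.1 p.2.1 p.2.2 := by
  have hT : Measurable fun p : XState × A × 𝒵 => m.T p.1.1 p.2.1 p.2.2 :=
    m.measurable_T.comp (f := fun p : XState × A × 𝒵 => (p.1.1, p.2.1, p.2.2)) (by fun_prop)
  have hc : Measurable fun p : XState × A × 𝒵 => m.c p.1.1 p.2.1 (m.T p.1.1 p.2.1 p.2.2) :=
    m.measurable_c.comp (f := fun p : XState × A × 𝒵 => (p.1.1, p.2.1, m.T p.1.1 p.2.1 p.2.2))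
      (by fun_prop)
  refine hT.prodMk (Measurable.prodMk ?_ ?_)
  · have ht : Measurable fun p : XState × A × 𝒵 => (p.1.2.2 : ℝ≥0) :=
      measurable_subtype_coe.comp (by fun_prop)
    exact (by fun_prop : Measurable fun p : XState × A × 𝒵 => p.1.2.1).add (ht.mul hc)
  · have ht : Measurable fun p : XState × A × 𝒵 => (p.1.2.2 : ℝ≥0) :=
      measurable_subtype_coe.comp (by fun_prop)
    exact (ht.const_mul (m.β : ℝ≥0)).subtype_mk

theorem measurable_comp_step (m : Model A 𝒵) {W : Ω → 𝒵} (hW : Measurable W)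
    {v : XState → ℝ≥0∞} (hv : Measurable v) (y : XState) (a : A) :
    Measurable fun ω => v (m.step y a (W ω)) :=
  hv.comp (m.measurable_step.comp (f := fun ω => (y, a, W ω)) (by fun_prop))

theorem opL_mono (m : Model A 𝒵) (P : Measure Ω) (W : Ω → 𝒵) {v w : XState → ℝ≥0∞}
    (h : v ≤ w) (y : XState) (a : A) : m.opL P W v y a ≤ m.opL P W w y a :=
  lintegral_mono fun _ => h _

theorem bellman_mono (m : Model A 𝒵) (P : Measure Ω) (W : Ω → 𝒵) : Monotone (m.bellman P W) :=
  fun _ _ h y => iInf₂_mono fun a _ => m.opL_mono P W h y a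

theorem bellman_le_opL (m : Model A 𝒵) (P : Measure Ω) (W : Ω → 𝒵) (v : XState → ℝ≥0∞)
    {y : XState} {a : A} (ha : (y.1, a) ∈ m.D) : m.bellman P W v y ≤ m.opL P W v y a :=
  iInf₂_le a ha

theorem le_bellman (m : Model A 𝒵) (P : Measure Ω) [IsProbabilityMeasure P] (W : Ω → 𝒵)
    {g : ℝ → ℝ} (hg : Monotone g) {v : XState → ℝ≥0∞}
    (hv : ∀ y, ENNReal.ofReal (g y.2.1) ≤ v y) (y : XState) :
    ENNReal.ofReal (g y.2.1) ≤ m.bellman P W v y := by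
  refine le_iInf₂ fun a _ => ?_
  calc ENNReal.ofReal (g y.2.1) = ∫⁻ _, ENNReal.ofReal (g y.2.1) ∂P := by simp
    _ ≤ _ := lintegral_mono fun ω => le_trans (ENNReal.ofReal_le_ofReal (hg ?_)) (hv _)
  simp only [step, NNReal.coe_add, le_add_iff_nonneg_right]
  positivity

/-- Admissible pairs of extended states and actions. -/
def admissible (m : Model A 𝒵) : Set (XState × A) := {p | (p.1.1, p.2) ∈ m.D}

theorem section_nonempty (m : Model A 𝒵) (x : ℝ) : {a | (x, a) ∈ m.D}.Nonempty := by
  obtain ⟨f, -, hf⟩ := m.exists_selector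
  exact ⟨f x, hf x⟩

variable [TopologicalSpace A]

theorem lsc_section {m : Model A 𝒵} {u : XState × A → ℝ≥0∞}
    (hu : LowerSemicontinuousOn u m.admissible) (y : XState) :
    LowerSemicontinuousOn (fun a => u (y, a)) {a | (y.1, a) ∈ m.D} :=
  hu.comp (by fun_prop : Continuous fun a : A => (y, a)).continuousOn fun _ ha => ha

theorem IsMonotone.exists_min {m : Model A 𝒵} (hm : m.IsMonotone)
    {u : XState × A → ℝ≥0∞} (hu : LowerSemicontinuousOn u m.admissible) (y : XState) {F : Set A}
    (hF : IsClosed F) (hne : ({a | (y.1, a) ∈ m.D} ∩ F).Nonempty) :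
    ∃ a ∈ F, (y.1, a) ∈ m.D ∧ ∀ b ∈ F, (y.1, b) ∈ m.D → u (y, a) ≤ u (y, b) := by
  obtain ⟨a, ha, hmin⟩ := ((lsc_section hu y).mono
    Set.inter_subset_left).exists_isMinOn hne ((hm.compact_D y.1).inter_right hF)
  exact ⟨a, ha.2, ha.1, fun b hb hbD => hmin ⟨hbD, hb⟩⟩

theorem IsMonotone.exists_bellman_eq {m : Model A 𝒵} (hm : m.IsMonotone) {P : Measure Ω}
    {W : Ω → 𝒵} {v : XState → ℝ≥0∞}
    (hu : LowerSemicontinuousOn (fun p : XState × A => m.opL P W v p.1 p.2) m.admissible)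
    (y : XState) : ∃ a, (y.1, a) ∈ m.D ∧ m.opL P W v y a = m.bellman P W v y := by
  obtain ⟨a, -, ha, hmin⟩ := hm.exists_min hu y isClosed_univ
    (by simpa using m.section_nonempty y.1)
  exact ⟨a, ha, le_antisymm (le_iInf₂ fun b hb => hmin b trivial hb) (m.bellman_le_opL P W v ha)⟩

theorem IsMonotone.step_le_step {m : Model A 𝒵} (hm : m.IsMonotone) {y y' : XState} (h : y ≤ y')
    {a : A} (ha : (y'.1, a) ∈ m.D) (z : 𝒵) : m.step y a z ≤ m.step y' a z := by
  have ha' := hm.antitone_D _ _ _ h.1 ha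
  refine ⟨hm.mono_T z _ _ a ha' ha h.1, ?_, ?_⟩
  · exact add_le_add h.2.1 (mul_le_mul' h.2.2 (hm.mono_c z _ _ a ha' ha h.1))
  · exact mul_le_mul_right (α := ℝ≥0) h.2.2 (m.β : ℝ≥0)

/-- The transition itself need not converge. Truncating `T` and `c` at their values in `p` gives
states `Y q` that lie below the true successors and converge to the successor of `p`. Lower
semicontinuity of `v` applies along `Y`, and monotonicity of `v` in all variables passes the bound
on to the true successors. -/
theorem IsMonotone.lsc_comp_step {m : Model A 𝒵} (hm : m.IsMonotone) {v : XState → ℝ≥0∞}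
    (hv : LowerSemicontinuous v) (hmono : Monotone v) (z : 𝒵) :
    LowerSemicontinuousOn (fun p : XState × A => v (m.step p.1 p.2 z)) m.admissible := by
  rintro p hp r hr
  set Y : XState × A → XState := fun q =>
    (min (m.T q.1.1 q.2 z) (m.T p.1.1 p.2 z),
      q.1.2.1 + q.1.2.2.1 * min (m.c q.1.1 q.2 (m.T q.1.1 q.2 z)) (m.c p.1.1 p.2 (m.T p.1.1 p.2 z)),
      m.β * q.1.2.2) with hY
  have hπ : Tendsto (fun q : XState × A => (q.1.1, q.2)) (𝓝[m.admissible] p) (𝓝[m.D] (p.1.1, p.2)) :=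
    tendsto_nhdsWithin_iff.2 ⟨((by fun_prop : Continuous fun q : XState × A => (q.1.1, q.2)).tendsto
      p).mono_left nhdsWithin_le_nhds, eventually_mem_nhdsWithin⟩
  have hT := (LowerSemicontinuousWithinAt.tendsto_min (hm.lsc_T z _ hp)).comp hπ
  have hc := (LowerSemicontinuousWithinAt.tendsto_min (hm.lsc_c z _ hp)).comp hπ
  have hs : Tendsto (fun q : XState × A => q.1.2.1) (𝓝[m.admissible] p) (𝓝 p.1.2.1) :=
    ((by fun_prop : Continuous fun q : XState × A => q.1.2.1).tendsto p).mono_left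
      nhdsWithin_le_nhds
  have ht : Tendsto (fun q : XState × A => (q.1.2.2 : ℝ≥0)) (𝓝[m.admissible] p) (𝓝 p.1.2.2) :=
    ((by fun_prop : Continuous fun q : XState × A => (q.1.2.2 : ℝ≥0)).tendsto p).mono_left
      nhdsWithin_le_nhds
  have hlim : Tendsto Y (𝓝[m.admissible] p) (𝓝 (m.step p.1 p.2 z)) :=
    hT.prodMk_nhds ((hs.add (ht.mul hc)).prodMk_nhds
      (tendsto_subtype_rng.2 (ht.const_mul (m.β : ℝ≥0))))
  filter_upwards [hlim.eventually (hv _ r hr)] with q hq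
  refine hq.trans_le (hmono ⟨min_le_left _ _, ?_, le_rfl⟩)
  exact add_le_add le_rfl (mul_le_mul' le_rfl (min_le_left _ _))

variable [TopologicalSpace.MetrizableSpace A]

theorem IsMonotone.lsc_opL {m : Model A 𝒵} (hm : m.IsMonotone) (P : Measure Ω)
    {W : Ω → 𝒵} (hW : Measurable W) {v : XState → ℝ≥0∞}
    (hv : LowerSemicontinuous v) (hmono : Monotone v) :
    LowerSemicontinuousOn (fun p : XState × A => m.opL P W v p.1 p.2) m.admissible := by
  refine LowerSemicontinuousOn.lintegral
    (fun p => m.measurable_comp_step hW hv.measurable p.1 p.2) fun ω => ?_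
  exact hm.lsc_comp_step hv hmono (W ω)

/-- Upper semicontinuity of `D` supplies an admissible accumulation point of the witnessing actions;
closedness of `F` and lower semicontinuity of `u` preserve the two constraints along a subsequence.
-/
theorem IsMonotone.isClosed_exists_le {m : Model A 𝒵} (hm : m.IsMonotone)
    {u : XState × A → ℝ≥0∞} (hu : LowerSemicontinuousOn u m.admissible) {F : Set A}
    (hF : IsClosed F) (r : ℝ≥0∞) :
    IsClosed {y : XState | ∃ a ∈ F, (y.1, a) ∈ m.D ∧ u (y, a) ≤ r} := by
  refine IsSeqClosed.isClosed fun ys y hys hy => ?_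
  choose as haF haD hau using hys
  obtain ⟨a, haD', hcl⟩ := hm.usc_D (fun k => (ys k).1) y.1 as
    ((continuous_fst.tendsto y).comp hy) haD
  obtain ⟨ψ, hψ, hlim⟩ := hcl.tendsto_subseq
  refine ⟨a, hF.mem_of_tendsto hlim (Eventually.of_forall fun k => haF _), haD', ?_⟩
  by_contra! hlt
  have hpair : Tendsto (fun k => (ys (ψ k), as (ψ k))) atTop (𝓝[m.admissible] (y, a)) :=
    tendsto_nhdsWithin_iff.2 ⟨(hy.comp hψ.tendsto_atTop).prodMk_nhds hlim,
      Eventually.of_forall fun k => haD _⟩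
  obtain ⟨k, hk⟩ := (hpair.eventually (hu (y, a) haD' r hlt)).exists
  exact absurd (hau (ψ k)) (not_le.2 hk)

/-- Since the infimum is attained, a sublevel set consists of the states with some action of value
at most `r`, and such sets are closed. -/
theorem IsMonotone.lsc_bellman {m : Model A 𝒵} (hm : m.IsMonotone) {P : Measure Ω}
    {W : Ω → 𝒵} {v : XState → ℝ≥0∞}
    (hu : LowerSemicontinuousOn (fun p : XState × A => m.opL P W v p.1 p.2) m.admissible) :
    LowerSemicontinuous (m.bellman P W v) := by
  refine lowerSemicontinuous_iff_isClosed_preimage.2 fun r => ?_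
  have : m.bellman P W v ⁻¹' Set.Iic r =
      {y : XState | ∃ a ∈ Set.univ, (y.1, a) ∈ m.D ∧ m.opL P W v y a ≤ r} := by
    ext y
    constructor
    · intro hy
      obtain ⟨a, ha, heq⟩ := hm.exists_bellman_eq hu y
      exact ⟨a, trivial, ha, heq.le.trans hy⟩
    · rintro ⟨a, -, ha, hle⟩
      exact (m.bellman_le_opL P W v ha).trans hle
  rw [this]
  exact hm.isClosed_exists_le hu isClosed_univ r

/-- For monotonicity, an action admissible at the larger state is admissible at the smaller one and
leads to a smaller successor there. -/
theorem IsMonotone.bellman_mem {m : Model A 𝒵} (hm : m.IsMonotone) (P : Measure Ω)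
    [IsProbabilityMeasure P] {W : Ω → 𝒵} (hW : Measurable W) {g : ℝ → ℝ} (hg : Monotone g)
    {v : XState → ℝ≥0∞} (hv : v ∈ monotoneValueFunctions g) :
    m.bellman P W v ∈ monotoneValueFunctions g := by
  refine ⟨hm.lsc_bellman (hm.lsc_opL P hW hv.1 hv.2.1), fun y y' hy => ?_,
    m.le_bellman P W hg hv.2.2⟩
  refine le_iInf₂ fun a ha => ?_
  exact (m.bellman_le_opL P W v (hm.antitone_D _ _ _ hy.1 ha)).trans
    (lintegral_mono fun ω => hv.2.1 (hm.step_le_step hy ha (W ω)))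

theorem IsMonotone.exists_rule [SecondCountableTopology A] [BorelSpace A] {m : Model A 𝒵}
    (hm : m.IsMonotone) (P : Measure Ω) {W : Ω → 𝒵} (hW : Measurable W) {g : ℝ → ℝ}
    {v : XState → ℝ≥0∞} (hv : v ∈ monotoneValueFunctions g) :
    ∃ d : m.MarkovRule, m.opRule P W d v = m.bellman P W v := by
  have hu := hm.lsc_opL P hW hv.1 hv.2.1
  have hφ : Measurable (m.bellman P W v) := (hm.lsc_bellman hu).measurable
  obtain ⟨S, hSc, hSd⟩ := TopologicalSpace.exists_countable_dense ℝ≥0∞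
  have hK : IsMeasurableCorrespondence fun y : XState =>
      {a | (y.1, a) ∈ m.D ∧ m.opL P W v y a ≤ m.bellman P W v y} := by
    refine ⟨fun y => ?_, fun y => ?_, fun F hF => ?_⟩
    · exact (lsc_section hu y).isCompact_inter_preimage_Iic (hm.compact_D y.1) _
    · obtain ⟨a, ha, heq⟩ := hm.exists_bellman_eq hu y
      exact ⟨a, ha, heq.le⟩
    -- The minimum over `F` is at most the Bellman value iff no threshold separates them; a
    -- countable dense set of thresholds suffices. The bound `∞` only says that the section meets
    -- `F`.
    · have : {y : XState | ({a | (y.1, a) ∈ m.D ∧ m.opL P W v y a ≤ m.bellman P W v y} ∩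
            F).Nonempty} =
          {y : XState | ∃ a ∈ F, (y.1, a) ∈ m.D ∧ m.opL P W v y a ≤ ∞} ∩
          ⋂ r ∈ S, ({y | m.bellman P W v y < r}ᶜ ∪
            {y : XState | ∃ a ∈ F, (y.1, a) ∈ m.D ∧ m.opL P W v y a ≤ r}) := by
        ext y
        simp only [Set.mem_ofPred_eq, Set.mem_inter_iff, Set.mem_iInter, Set.mem_union,
          Set.mem_compl_iff]
        constructor
        · rintro ⟨a, ⟨haD, hle⟩, haF⟩
          refine ⟨⟨a, haF, haD, le_top⟩, fun r _ => or_iff_not_imp_left.2 fun h => ?_⟩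
          exact ⟨a, haF, haD, hle.trans (not_not.1 h).le⟩
        · rintro ⟨⟨a₀, ha₀F, ha₀D, -⟩, h⟩
          obtain ⟨a, haF, haD, hmin⟩ := hm.exists_min hu y hF ⟨a₀, ha₀D, ha₀F⟩
          refine ⟨a, ⟨haD, ?_⟩, haF⟩
          by_contra! hlt
          obtain ⟨r, hrS, hr1, hr2⟩ := hSd.exists_between hlt
          rcases h r hrS with h | ⟨b, hbF, hbD, hb⟩
          · exact h hr1
          · exact absurd ((hmin b hbF hbD).trans hb) (not_le.2 hr2)
      rw [this]
      refine (hm.isClosed_exists_le hu hF ∞).measurableSet.inter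
        (MeasurableSet.biInter hSc fun r _ => ?_)
      exact (measurableSet_lt hφ measurable_const).compl.union
        (hm.isClosed_exists_le hu hF r).measurableSet
  obtain ⟨f, hf, hfK⟩ := hK.exists_measurable_selection
  refine ⟨⟨f, hf, fun y => (hfK y).1⟩, funext fun y => ?_⟩
  exact le_antisymm (hfK y).2 (m.bellman_le_opL P W v (hfK y).1)

end RiskMDP.Model

/-! ### Histories, the Markov property and verification inequalities. -/

theorem measurable_finSnoc {n : ℕ} {Y Ω : Type*} [MeasurableSpace Y] [MeasurableSpace Ω]
    {f : Ω → Fin n → Y} {y : Ω → Y} (hf : Measurable f) (hy : Measurable y) :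
    Measurable fun ω => (Fin.snoc (α := fun _ => Y) (f ω) (y ω) : Fin (n + 1) → Y) := by
  refine measurable_pi_iff.2 fun i => ?_
  induction i using Fin.lastCases with
  | last => simpa using hy
  | cast i => simpa [Function.comp_def] using (measurable_pi_apply i).comp hf

namespace RiskMDP

theorem Hist.measurable_last {A : Type*} [MeasurableSpace A] {n : ℕ} :
    Measurable (Hist.last : Hist A n → XState) :=
  (measurable_pi_apply (Fin.last n)).comp measurable_fst

@[simp]
theorem Hist.last_snoc {A : Type*} {n : ℕ} (h : Hist A n) (a : A) (y : XState) :
    (h.snoc a y).last = y := by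
  simp [Hist.snoc, Hist.last]

namespace Model

variable {A 𝒵 Ω : Type*} [MeasurableSpace A] [MeasurableSpace 𝒵] [MeasurableSpace Ω]
  {m : Model A 𝒵}

theorem history_succ_last (π : m.Policy) (z : ℕ → 𝒵) {n : ℕ} (h : Hist A n) (k : ℕ) :
    (m.history π z n h (k + 1)).last = m.step (m.history π z n h k).last
      (π.rule (n + k) (m.history π z n h k)) (z (n + k)) :=
  Hist.last_snoc _ _ _

theorem Feasible.snoc {n : ℕ} {h : Hist A n} (hh : m.Feasible h) {a : A}
    (ha : (h.last.1, a) ∈ m.D) (y : XState) : m.Feasible (h.snoc a y) := by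
  intro k
  induction k using Fin.lastCases with
  | last => simpa [Hist.snoc, Hist.last] using ha
  | cast i => simpa [Hist.snoc, ← Fin.castSucc_succ] using hh i

theorem Feasible.history {n : ℕ} {h : Hist A n} (hh : m.Feasible h) (π : m.Policy) (z : ℕ → 𝒵)
    (k : ℕ) : m.Feasible (m.history π z n h k) := by
  induction k with
  | zero => exact hh
  | succ k ih => exact ih.snoc (π.mem_D _ _ ih) _

theorem history_congr (π : m.Policy) {z z' : ℕ → 𝒵} {n : ℕ} (h : Hist A n) (k : ℕ)
    (hz : ∀ j < n + k, z j = z' j) : m.history π z n h k = m.history π z' n h k := by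
  induction k with
  | zero => rfl
  | succ k ih =>
    have := ih fun j hj => hz j (by omega)
    simp only [Model.history, this, hz (n + k) (by omega)]

theorem measurable_history (π : m.Policy) {n : ℕ} (h : Hist A n) (k : ℕ) :
    Measurable fun z : ℕ → 𝒵 => m.history π z n h k := by
  induction k with
  | zero => exact measurable_const
  | succ k ih =>
    have hr := (π.measurable_rule (n + k)).comp ih
    refine (measurable_finSnoc (measurable_fst.comp ih) ?_).prodMk
      (measurable_finSnoc (measurable_snd.comp ih) hr)
    exact m.measurable_step.comp ((Hist.measurable_last.comp ih).prodMk
      (hr.prodMk (measurable_pi_apply (n + k))))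

/-- The last two state components record the accumulated discounted cost and the current discount
factor. -/
theorem history_last_snd (π : m.Policy) (z : ℕ → 𝒵) {n : ℕ} (h : Hist A n) (k : ℕ) :
    (m.history π z n h k).last.2.1 = h.last.2.1 + h.last.2.2.1 *
      ∑ j ∈ Finset.range k, m.β.1 ^ j * m.stageCost π z n h j ∧
    (m.history π z n h k).last.2.2.1 = m.β.1 ^ k * h.last.2.2.1 := by
  induction k with
  | zero => simp [Model.history]
  | succ k ih =>
    have hc : m.stageCost π z n h k = m.c (m.history π z n h k).last.1
        (π.rule (n + k) (m.history π z n h k)) (m.T (m.history π z n h k).last.1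
        (π.rule (n + k) (m.history π z n h k)) (z (n + k))) := by
      rw [stageCost, history_succ_last]; rfl
    rw [history_succ_last]
    constructor
    · rw [Finset.sum_range_succ, hc]
      simp only [step]
      rw [ih.1, ih.2]
      ring
    · simp only [step]
      change m.β.1 * (m.history π z n h k).last.2.2.1 = _
      rw [ih.2]
      ring

theorem policyValue_eq (g : ℝ → ℝ) (P : Measure Ω) (Z : ℕ → Ω → 𝒵) (N : ℕ) {n : ℕ}
    (π : m.Policy) (h : Hist A n) :
    m.policyValue g P Z N n π h =
      ∫⁻ ω, ENNReal.ofReal (g (m.history π (fun j => Z j ω) n h (N - n)).last.2.1) ∂P := by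
  simp only [history_last_snd, policyValue]

theorem markovState_eq (π : m.MarkovPolicy) (z : ℕ → 𝒵) {n : ℕ} (h : Hist A n) (k : ℕ) :
    m.markovState π z n h.last k = (m.history π.toPolicy z n h k).last := by
  induction k with
  | zero => rfl
  | succ k ih => rw [history_succ_last, markovState, ih]; rfl

theorem markovStageCost_eq (π : m.MarkovPolicy) (z : ℕ → 𝒵) {n : ℕ} (h : Hist A n) (k : ℕ) :
    m.markovStageCost π z n h.last k = m.stageCost π.toPolicy z n h k := by
  simp only [markovStageCost, markovState_eq, stageCost]; rfl

theorem markovPolicyValue_last (g : ℝ → ℝ) (P : Measure Ω) (Z : ℕ → Ω → 𝒵) (N : ℕ) {n : ℕ}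
    (π : m.MarkovPolicy) (h : Hist A n) :
    m.markovPolicyValue g P Z N n π h.last = m.policyValue g P Z N n π.toPolicy h := by
  simp only [markovPolicyValue, policyValue, markovStageCost_eq]

/-- Feasibility constrains actions only, so a constant sequence of states works even if the dynamics
could never produce it. -/
theorem exists_feasible_last (m : Model A 𝒵) (n : ℕ) (y : XState) :
    ∃ h : Hist A n, m.Feasible h ∧ h.last = y := by
  obtain ⟨f, -, hf⟩ := m.exists_selector
  exact ⟨(fun _ => y, fun _ => f y.1), fun _ => hf _, rfl⟩

section Dynamics

variable {P : Measure Ω} [IsProbabilityMeasure P] {Z : ℕ → Ω → 𝒵}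

theorem indepFun_history (hZ : ∀ n, Measurable (Z n)) (hindep : iIndepFun Z P) (π : m.Policy)
    {n : ℕ} (h : Hist A n) (k : ℕ) :
    IndepFun (fun ω => m.history π (fun j => Z j ω) n h k) (Z (n + k)) P := by
  -- The sample point `ω₀` fills in the disturbances from time `n + k` on, on which the history up
  -- to that time does not depend.
  obtain ⟨ω₀⟩ := nonempty_of_isProbabilityMeasure P
  have hind := hindep.indepFun_finset (Finset.range (n + k)) {n + k} (by simp) hZ
  have hφ : Measurable fun w : Finset.range (n + k) → 𝒵 => m.history π
      (fun j => if hj : j ∈ Finset.range (n + k) then w ⟨j, hj⟩ else Z j ω₀) n h k := by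
    refine (measurable_history π h k).comp (measurable_pi_iff.2 fun j => ?_)
    by_cases hj : j ∈ Finset.range (n + k)
    · simpa only [hj, dif_pos] using measurable_pi_apply _
    · simpa only [hj, dif_neg, not_false_eq_true] using measurable_const
  have heq : (fun ω => m.history π (fun j => Z j ω) n h k) = (fun w : Finset.range (n + k) → 𝒵 =>
      m.history π (fun j => if hj : j ∈ Finset.range (n + k) then w ⟨j, hj⟩ else Z j ω₀) n h k) ∘
      fun ω i => Z i ω := by
    funext ω
    refine history_congr π h k fun j hj => ?_
    simp [hj]
  rw [heq]
  exact hind.comp hφ (measurable_pi_apply (⟨n + k, by simp⟩ : ({n + k} : Finset ℕ)))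

/-- The Markov property: the next disturbance is independent of the history, so Fubini integrates it
out first. -/
theorem lintegral_history_succ (hZ : ∀ n, Measurable (Z n)) (hindep : iIndepFun Z P)
    (hident : ∀ n, IdentDistrib (Z n) (Z 0) P P) (π : m.Policy) {n : ℕ} (h : Hist A n) (k : ℕ)
    {v : XState → ℝ≥0∞} (hv : Measurable v) :
    ∫⁻ ω, v (m.history π (fun j => Z j ω) n h (k + 1)).last ∂P =
      ∫⁻ ω, m.opL P (Z 0) v (m.history π (fun j => Z j ω) n h k).last
        (π.rule (n + k) (m.history π (fun j => Z j ω) n h k)) ∂P := by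
  set H : Ω → Hist A (n + k) := fun ω => m.history π (fun j => Z j ω) n h k with hH
  have hHm : Measurable H := (measurable_history π h k).comp (measurable_pi_iff.2 hZ)
  have hΦ : Measurable fun p : Hist A (n + k) × 𝒵 =>
      v (m.step p.1.last (π.rule (n + k) p.1) p.2) :=
    hv.comp (m.measurable_step.comp ((Hist.measurable_last.comp measurable_fst).prodMk
      (((π.measurable_rule _).comp measurable_fst).prodMk measurable_snd)))
  calc ∫⁻ ω, v (m.history π (fun j => Z j ω) n h (k + 1)).last ∂P
      = ∫⁻ p, v (m.step p.1.last (π.rule (n + k) p.1) p.2) ∂(P.map fun ω => (H ω, Z (n + k) ω)) := by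
        rw [lintegral_map hΦ (hHm.prodMk (hZ _))]
        simp only [history_succ_last, hH]
    _ = ∫⁻ p, v (m.step p.1.last (π.rule (n + k) p.1) p.2) ∂((P.map H).prod (P.map (Z 0))) := by
        rw [(indepFun_iff_map_prod_eq_prod_map_map hHm.aemeasurable (hZ _).aemeasurable).1
          (indepFun_history hZ hindep π h k), (hident (n + k)).map_eq]
    _ = ∫⁻ q, ∫⁻ z, v (m.step q.last (π.rule (n + k) q) z) ∂(P.map (Z 0)) ∂(P.map H) :=
        have : IsProbabilityMeasure (P.map (Z 0)) :=
          Measure.isProbabilityMeasure_map (hZ 0).aemeasurable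
        lintegral_prod _ hΦ.aemeasurable
    _ = _ := by
        have : IsProbabilityMeasure (P.map (Z 0)) :=
          Measure.isProbabilityMeasure_map (hZ 0).aemeasurable
        rw [lintegral_map (Measurable.lintegral_prod_right hΦ) hHm]
        refine lintegral_congr fun ω => ?_
        exact lintegral_map (hΦ.comp measurable_prodMk_left) (hZ 0)

/-- A submartingale argument: any admissible action costs at least the Bellman infimum, whatever the
policy remembers. -/
theorem le_lintegral_history (hZ : ∀ n, Measurable (Z n)) (hindep : iIndepFun Z P)
    (hident : ∀ n, IdentDistrib (Z n) (Z 0) P P) (π : m.Policy) {n : ℕ} {h : Hist A n}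
    (hh : m.Feasible h) {u : ℕ → XState → ℝ≥0∞} (hu : ∀ k, Measurable (u k)) (K : ℕ)
    (hle : ∀ k < K, u k ≤ m.bellman P (Z 0) (u (k + 1))) :
    u 0 h.last ≤ ∫⁻ ω, u K (m.history π (fun j => Z j ω) n h K).last ∂P := by
  induction K with
  | zero => simp [history]
  | succ K ih =>
    refine (ih fun k hk => hle k (by omega)).trans ?_
    rw [lintegral_history_succ hZ hindep hident π h K (hu (K + 1))]
    refine lintegral_mono fun ω => (hle K (by omega) _).trans ?_
    exact m.bellman_le_opL P (Z 0) _ (π.mem_D _ _ (hh.history π _ K))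

/-- The martingale counterpart, for a Markov policy whose rules reproduce `u` exactly. -/
theorem lintegral_history_eq (hZ : ∀ n, Measurable (Z n)) (hindep : iIndepFun Z P)
    (hident : ∀ n, IdentDistrib (Z n) (Z 0) P P) (π : m.MarkovPolicy) {n : ℕ} (h : Hist A n)
    {u : ℕ → XState → ℝ≥0∞} (hu : ∀ k, Measurable (u k)) (K : ℕ)
    (heq : ∀ k < K, m.opRule P (Z 0) (π (n + k)) (u (k + 1)) = u k) :
    ∫⁻ ω, u K (m.history π.toPolicy (fun j => Z j ω) n h K).last ∂P = u 0 h.last := by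
  induction K with
  | zero => simp [history]
  | succ K ih =>
    rw [← ih fun k hk => heq k (by omega),
      lintegral_history_succ hZ hindep hident π.toPolicy h K (hu (K + 1)), ← heq K (by omega)]
    rfl

end Dynamics

end Model

end RiskMDP

/-! ### Value iteration and its limit. -/

namespace RiskMDP

/-- Continuity of `g` handles a finite supremum; at an infinite one the value `g(∞)` is by
definition the supremum. -/
theorem extend_iSup {g : ℝ → ℝ} (hg : Monotone g) (hgc : Continuous g) {S : ℕ → ℝ≥0}
    (hS : Monotone S) : extend g (⨆ i, (S i : ℝ≥0∞)) = ⨆ i, ENNReal.ofReal (g (S i)) := by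
  unfold extend
  have hmono : Monotone fun i => ENNReal.ofReal (g (S i)) := fun i j hij =>
    ENNReal.ofReal_le_ofReal (hg (NNReal.coe_le_coe.2 (hS hij)))
  split_ifs with h
  · refine le_antisymm (iSup_le fun r => ?_) (iSup_le fun i => le_iSup
      (fun r : ℝ≥0 => ENNReal.ofReal (g r)) (S i))
    have hr : (r : ℝ≥0∞) < ⨆ i, (S i : ℝ≥0∞) := h ▸ ENNReal.coe_lt_top
    obtain ⟨i, hi⟩ := lt_iSup_iff.1 hr
    exact le_iSup_of_le i (ENNReal.ofReal_le_ofReal (hg (ENNReal.coe_lt_coe.1 hi).le))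
  · have h1 : Tendsto (fun i => (S i : ℝ≥0∞)) atTop (𝓝 (⨆ i, (S i : ℝ≥0∞))) :=
      tendsto_atTop_iSup fun i j hij => ENNReal.coe_le_coe.2 (hS hij)
    have h2 := (ENNReal.tendsto_toReal h).comp h1
    exact tendsto_nhds_unique ((ENNReal.continuous_ofReal.comp hgc).tendsto _ |>.comp h2)
      (tendsto_atTop_iSup hmono)

theorem Hist.feasible_init {A 𝒵 : Type*} [MeasurableSpace A] [MeasurableSpace 𝒵] (m : Model A 𝒵)
    (y : XState) : m.Feasible (Hist.init A y) :=
  fun k => k.elim0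

namespace Model

variable {A 𝒵 Ω : Type*} [MeasurableSpace A] [MeasurableSpace 𝒵] [MeasurableSpace Ω]
  {m : Model A 𝒵}

/-- Value iteration starting from `(x, s, t) ↦ g s`. -/
noncomputable def iterValue (m : Model A 𝒵) (g : ℝ → ℝ) (P : Measure Ω) (W : Ω → 𝒵) (k : ℕ) :
    XState → ℝ≥0∞ :=
  (m.bellman P W)^[k] fun y => ENNReal.ofReal (g y.2.1)

theorem iterValue_succ (g : ℝ → ℝ) (P : Measure Ω) (W : Ω → 𝒵) (k : ℕ) :
    m.iterValue g P W (k + 1) = m.bellman P W (m.iterValue g P W k) :=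
  Function.iterate_succ_apply' _ _ _

theorem iterValue_monotone (m : Model A 𝒵) {g : ℝ → ℝ} (hg : Monotone g) (P : Measure Ω)
    [IsProbabilityMeasure P] (W : Ω → 𝒵) : Monotone (m.iterValue g P W) :=
  (m.bellman_mono P W).monotone_iterate_of_le_map (m.le_bellman P W hg fun _ => le_rfl)

/-- Only `v ≥ g s` and monotonicity of the operator enter, so leastness holds in `𝕄` as well as in
`𝕄'`. -/
theorem iterValue_le_of_fixed {g : ℝ → ℝ} {P : Measure Ω} {W : Ω → 𝒵} {v : XState → ℝ≥0∞}
    (hv : ∀ y : XState, ENNReal.ofReal (g y.2.1) ≤ v y) (hfix : m.bellman P W v = v) (k : ℕ) :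
    m.iterValue g P W k ≤ v := by
  induction k with
  | zero => exact hv
  | succ k ih =>
    rw [iterValue_succ, ← hfix]
    exact m.bellman_mono P W ih

/-- Partial sums of nonnegative costs increase, so `extend_iSup` applies pathwise and monotone
convergence in expectation. -/
theorem infPolicyValue_eq_iSup {g : ℝ → ℝ} (hg : Monotone g) (hgc : Continuous g)
    (P : Measure Ω) {Z : ℕ → Ω → 𝒵} (hZ : ∀ n, Measurable (Z n)) (π : m.MarkovPolicy)
    (y : XState) : m.infPolicyValue g P Z π y = ⨆ N, m.markovPolicyValue g P Z N 0 π y := by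
  set S : Ω → ℕ → ℝ≥0 := fun ω N => y.2.1 + y.2.2.1 *
    ∑ k ∈ Finset.range N, m.β.1 ^ k * m.markovStageCost π (fun j => Z j ω) 0 y k with hS
  have hSmono : ∀ ω, Monotone (S ω) := fun ω i j hij => by
    have := Finset.sum_le_sum_of_subset (f := fun k => m.β.1 ^ k *
      m.markovStageCost π (fun j => Z j ω) 0 y k) (Finset.range_mono hij)
    simp only [hS]
    gcongr
  have hSm : ∀ N, Measurable fun ω => S ω N := fun N => by
    have heq : (fun ω => S ω N) = fun ω =>
        (m.history π.toPolicy (fun j => Z j ω) 0 (Hist.init A y) N).last.2.1 := by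
      funext ω
      rw [(history_last_snd _ _ _ _).1]
      simp only [hS, ← markovStageCost_eq]
      rfl
    rw [heq]
    exact (measurable_fst.comp measurable_snd).comp (Hist.measurable_last.comp
      ((measurable_history _ _ _).comp (measurable_pi_iff.2 hZ)))
  have hpath : ∀ ω, (y.2.1 : ℝ≥0∞) + (y.2.2.1 : ℝ≥0∞) *
      ∑' k, ((m.β.1 ^ k * m.markovStageCost π (fun j => Z j ω) 0 y k : ℝ≥0) : ℝ≥0∞) =
      ⨆ N, (S ω N : ℝ≥0∞) := fun ω => by
    rw [ENNReal.tsum_eq_iSup_nat, ENNReal.mul_iSup, ENNReal.add_iSup]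
    simp only [hS]
    push_cast
    rfl
  simp only [infPolicyValue, hpath, extend_iSup hg hgc (hSmono _)]
  rw [lintegral_iSup]
  · rfl
  · exact fun N => (ENNReal.continuous_ofReal.comp
      (hgc.comp NNReal.continuous_coe)).measurable.comp (hSm N)
  · exact fun i j hij ω => ENNReal.ofReal_le_ofReal (hg (NNReal.coe_le_coe.2 (hSmono ω hij)))

section

variable [TopologicalSpace A] [TopologicalSpace.MetrizableSpace A]

theorem IsMonotone.iterValue_mem (hm : m.IsMonotone) (P : Measure Ω) [IsProbabilityMeasure P]
    {W : Ω → 𝒵} (hW : Measurable W) {g : ℝ → ℝ} (hg : Monotone g) (hgc : Continuous g) (k : ℕ) :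
    m.iterValue g P W k ∈ monotoneValueFunctions g := by
  induction k with
  | zero =>
    refine ⟨Continuous.lowerSemicontinuous (ENNReal.continuous_ofReal.comp
      (hgc.comp (by fun_prop))), fun y y' h => ?_, fun _ => le_rfl⟩
    exact ENNReal.ofReal_le_ofReal (hg (NNReal.coe_le_coe.2 h.2.1))
  | succ k ih =>
    rw [iterValue_succ]
    exact hm.bellman_mem P hW hg ih

theorem IsMonotone.iSup_iterValue_mem (hm : m.IsMonotone) (P : Measure Ω) [IsProbabilityMeasure P]
    {W : Ω → 𝒵} (hW : Measurable W) {g : ℝ → ℝ} (hg : Monotone g) (hgc : Continuous g) :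
    (fun y => ⨆ k, m.iterValue g P W k y) ∈ monotoneValueFunctions g := by
  have h := hm.iterValue_mem P hW hg hgc
  exact ⟨lowerSemicontinuous_iSup fun k => (h k).1, fun y y' hy => iSup_mono fun k => (h k).2.1 hy,
    fun y => le_iSup (fun k => m.iterValue g P W k y) 0⟩

/-- The nontrivial inequality exchanges infimum and supremum. The admissible actions with `k`-th
value at most `r` form decreasing nonempty compact sets; an action common to all of them has limit
value at most `r` by monotone convergence. -/
theorem IsMonotone.bellman_iSup_iterValue (hm : m.IsMonotone) (P : Measure Ω)
    [IsProbabilityMeasure P] {W : Ω → 𝒵} (hW : Measurable W) {g : ℝ → ℝ} (hg : Monotone g)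
    (hgc : Continuous g) : m.bellman P W (fun y => ⨆ k, m.iterValue g P W k y) =
      fun y => ⨆ k, m.iterValue g P W k y := by
  have hmem := hm.iterValue_mem P hW hg hgc
  have hmono := m.iterValue_monotone hg P W
  funext y
  apply le_antisymm
  · have hu := fun k => hm.lsc_opL P hW (hmem k).1 (hmem k).2.1
    set r := ⨆ k, m.iterValue g P W k y with hr
    have hC := fun k => (lsc_section (hu k) y).isCompact_inter_preimage_Iic (hm.compact_D y.1) r
    obtain ⟨a, ha⟩ := IsCompact.nonempty_iInter_of_sequence_nonempty_isCompact_isClosed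
      (fun k => {a | (y.1, a) ∈ m.D} ∩ (fun a => m.opL P W (m.iterValue g P W k) y a) ⁻¹' Set.Iic r)
      (fun k a ha => ⟨ha.1, (m.opL_mono P W (hmono k.le_succ) y a).trans ha.2⟩)
      (fun k => by
        -- A minimizer for the `k`-th iterate has value equal to the next iterate at `y`, which is
        -- at most `r`.
        obtain ⟨a, ha, heq⟩ := hm.exists_bellman_eq (hu k) y
        refine ⟨a, ha, heq.le.trans ?_⟩
        rw [← iterValue_succ]
        exact le_iSup (fun k => m.iterValue g P W k y) (k + 1)) (hC 0) (fun k => (hC k).isClosed)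
    rw [Set.mem_iInter] at ha
    refine (m.bellman_le_opL P W _ (ha 0).1).trans ?_
    have : m.opL P W (fun y => ⨆ k, m.iterValue g P W k y) y a =
        ⨆ k, m.opL P W (m.iterValue g P W k) y a :=
      lintegral_iSup (fun k => m.measurable_comp_step hW (hmem k).1.measurable y a)
        fun i j hij ω => hmono hij _
    rw [this]
    exact iSup_le fun k => (ha k).2
  · refine iSup_le fun k => (hmono k.le_succ y).trans ?_
    rw [Nat.succ_eq_add_one, iterValue_succ]
    exact m.bellman_mono P W (fun y => le_iSup (fun k => m.iterValue g P W k y) k) y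

/-- For `g = id` the accumulated cost is affine in the initial `s` and `t`: under the same action,
the successors from the two starting points are again related by `s + t * ·`. Hence a minimizer at
`(x, s', t')` serves at the transformed state too. -/
theorem IsMonotone.iterValue_id_le (hm : m.IsMonotone) (P : Measure Ω) [IsProbabilityMeasure P]
    {W : Ω → 𝒵} (hW : Measurable W) (k : ℕ) (x : ℝ) (s s' : ℝ≥0) (t t' : {t : ℝ≥0 // 0 < t}) :
    m.iterValue id P W k (x, s + t * s', t * t') ≤ s + t * m.iterValue id P W k (x, s', t') := by
  have hmem := hm.iterValue_mem P hW monotone_id continuous_id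
  induction k generalizing x s s' t t' with
  | zero => simp [iterValue]
  | succ k ih =>
    simp only [iterValue_succ]
    obtain ⟨a, ha, heq⟩ := hm.exists_bellman_eq (hm.lsc_opL P hW (hmem k).1 (hmem k).2.1)
      (x, s', t')
    rw [← heq]
    refine (m.bellman_le_opL P W _ (y := (x, s + t * s', t * t')) ha).trans ?_
    unfold opL
    rw [← lintegral_const_mul' _ _ ENNReal.coe_ne_top]
    calc ∫⁻ ω, m.iterValue id P W k (m.step (x, s + t * s', t * t') a (W ω)) ∂P
        ≤ ∫⁻ ω, s + t * m.iterValue id P W k (m.step (x, s', t') a (W ω)) ∂P := by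
          refine lintegral_mono fun ω => ?_
          refine le_trans (le_of_eq ?_) (ih _ s _ t _)
          congr 1
          simp only [step, Prod.mk.injEq, true_and]
          refine ⟨?_, mul_left_comm _ _ _⟩
          change s + t * s' + t.1 * t'.1 * _ = s + t.1 * (s' + t'.1 * _)
          ring
      _ = _ := by
          rw [lintegral_add_left measurable_const]
          simp

/-- The bound `g s ≤ g 0 + K s` survives each Bellman step, using a minimizer of the risk-neutral
problem. -/
theorem IsMonotone.iterValue_le_of_lipschitz (hm : m.IsMonotone) (P : Measure Ω)
    [IsProbabilityMeasure P] {W : Ω → 𝒵} (hW : Measurable W) {g : ℝ → ℝ} {K : ℝ≥0}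
    (hg : LipschitzWith K g) (k : ℕ) (y : XState) :
    m.iterValue g P W k y ≤ ENNReal.ofReal (g 0) + K * m.iterValue id P W k y := by
  have hmem := hm.iterValue_mem P hW monotone_id continuous_id
  induction k generalizing y with
  | zero =>
    have h1 : g y.2.1 ≤ g 0 + K * y.2.1 := by
      have := hg.dist_le_mul y.2.1 0
      rw [Real.dist_eq, Real.dist_eq, sub_zero, abs_of_nonneg y.2.1.coe_nonneg] at this
      linarith [le_abs_self (g y.2.1 - g 0)]
    refine (ENNReal.ofReal_le_ofReal h1).trans (ENNReal.ofReal_add_le.trans ?_)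
    rw [ENNReal.ofReal_mul K.coe_nonneg]
    simp [iterValue]
  | succ k ih =>
    simp only [iterValue_succ]
    obtain ⟨a, ha, heq⟩ := hm.exists_bellman_eq (hm.lsc_opL P hW (hmem k).1 (hmem k).2.1) y
    rw [← heq]
    refine (m.bellman_le_opL P W _ ha).trans ?_
    unfold opL
    rw [← lintegral_const_mul' _ _ ENNReal.coe_ne_top]
    refine (lintegral_mono fun ω => ih _).trans ?_
    rw [lintegral_add_left measurable_const]
    simp

variable {P : Measure Ω} [IsProbabilityMeasure P] {Z : ℕ → Ω → 𝒵}

theorem IsMonotone.iterValue_le_policyValue (hm : m.IsMonotone) (hZ : ∀ n, Measurable (Z n))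
    (hindep : iIndepFun Z P) (hident : ∀ n, IdentDistrib (Z n) (Z 0) P P) {g : ℝ → ℝ}
    (hg : Monotone g) (hgc : Continuous g) (N : ℕ) {n : ℕ} (π : m.Policy) {h : Hist A n}
    (hh : m.Feasible h) :
    m.iterValue g P (Z 0) (N - n) h.last ≤ m.policyValue g P Z N n π h := by
  have := le_lintegral_history hZ hindep hident π hh
    (u := fun k => m.iterValue g P (Z 0) (N - n - k))
    (fun k => (hm.iterValue_mem P (hZ 0) hg hgc _).1.measurable) (N - n) fun k hk => by
      rw [← iterValue_succ, show N - n - (k + 1) + 1 = N - n - k by omega]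
  rw [policyValue_eq]
  simpa [iterValue] using this

theorem IsMonotone.policyValue_eq_iterValue (hm : m.IsMonotone) (hZ : ∀ n, Measurable (Z n))
    (hindep : iIndepFun Z P) (hident : ∀ n, IdentDistrib (Z n) (Z 0) P P) {g : ℝ → ℝ}
    (hg : Monotone g) (hgc : Continuous g) {N n : ℕ} {π : m.MarkovPolicy}
    (hπ : ∀ k < N, m.opRule P (Z 0) (π k) (m.iterValue g P (Z 0) (N - (k + 1))) =
      m.iterValue g P (Z 0) (N - k)) (h : Hist A n) :
    m.policyValue g P Z N n π.toPolicy h = m.iterValue g P (Z 0) (N - n) h.last := by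
  have := lintegral_history_eq hZ hindep hident π h
    (u := fun k => m.iterValue g P (Z 0) (N - n - k))
    (fun k => (hm.iterValue_mem P (hZ 0) hg hgc _).1.measurable) (N - n) fun k hk => by
      have := hπ (n + k) (by omega)
      rwa [show N - n - (k + 1) = N - (n + k + 1) by omega,
        show N - n - k = N - (n + k) by omega]
  rw [policyValue_eq]
  simpa [iterValue] using this

theorem IsMonotone.iterValue_le_expectedCost (hm : m.IsMonotone) (hZ : ∀ n, Measurable (Z n))
    (hindep : iIndepFun Z P) (hident : ∀ n, IdentDistrib (Z n) (Z 0) P P) {g : ℝ → ℝ}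
    {K : ℝ≥0} (hg : LipschitzWith K g) (k N : ℕ) (hkN : k ≤ N) (π : m.Policy) (y : XState) :
    m.iterValue g P (Z 0) k y ≤
      ENNReal.ofReal (g 0) + K * (y.2.1 + y.2.2.1 * m.expectedCost P Z N π y.1) := by
  refine (hm.iterValue_le_of_lipschitz P (hZ 0) hg k y).trans ?_
  -- Taking `s' = 0` and `t' = 1` reduces to the start `(x, 0, 1)`, where the risk-neutral value of
  -- a policy is its expected cost.
  have h1 := hm.iterValue_id_le P (hZ 0) k y.1 y.2.1 0 y.2.2 ⟨1, one_pos⟩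
  have h2 := hm.iterValue_le_policyValue hZ hindep hident monotone_id continuous_id N π
    (Hist.feasible_init m (y.1, 0, ⟨1, one_pos⟩))
  have h3 : m.policyValue id P Z N 0 π (Hist.init A (y.1, 0, ⟨1, one_pos⟩)) =
      m.expectedCost P Z N π y.1 := by
    refine lintegral_congr fun ω => ?_
    exact ENNReal.ofReal_coe_nnreal.trans (congrArg _ ((zero_add _).trans (one_mul _)))
  rw [h3] at h2
  have h4 := (m.iterValue_monotone monotone_id P (Z 0) hkN _).trans h2
  have h5 : ((y.1, y.2.1 + y.2.2 * 0, y.2.2 * ⟨1, one_pos⟩) : XState) = y := by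
    refine Prod.ext rfl (Prod.ext (by simp) (Subtype.ext ?_))
    exact mul_one y.2.2.1
  rw [h5] at h1
  gcongr
  refine h1.trans ?_
  gcongr
  exact h4

variable [SecondCountableTopology A] [BorelSpace A]

theorem IsMonotone.exists_optimal_policy (hm : m.IsMonotone) {W : Ω → 𝒵} (hW : Measurable W)
    {g : ℝ → ℝ} (hg : Monotone g) (hgc : Continuous g) (N : ℕ) :
    ∃ π : m.MarkovPolicy, ∀ k < N, m.opRule P W (π k) (m.iterValue g P W (N - (k + 1))) =
      m.iterValue g P W (N - k) := by
  choose d hd using fun k => hm.exists_rule P hW (hm.iterValue_mem P hW hg hgc k)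
  -- After the decision at time `k`, `N - (k + 1)` stages remain, so the rule minimizes that
  -- iterate.
  refine ⟨fun k => d (N - (k + 1)), fun k hk => ?_⟩
  rw [hd, ← iterValue_succ, show N - (k + 1) + 1 = N - k by omega]

theorem IsMonotone.markovValue_eq (hm : m.IsMonotone) (hZ : ∀ n, Measurable (Z n))
    (hindep : iIndepFun Z P) (hident : ∀ n, IdentDistrib (Z n) (Z 0) P P) {g : ℝ → ℝ}
    (hg : Monotone g) (hgc : Continuous g) (N n : ℕ) :
    m.markovValue g P Z N n = m.iterValue g P (Z 0) (N - n) := by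
  funext y
  obtain ⟨h, hh, rfl⟩ := m.exists_feasible_last n y
  apply le_antisymm
  · obtain ⟨π, hπ⟩ := hm.exists_optimal_policy (P := P) (hZ 0) hg hgc N
    refine (iInf_le _ π).trans ?_
    rw [markovPolicyValue_last, hm.policyValue_eq_iterValue hZ hindep hident hg hgc hπ]
  · refine le_iInf fun π => ?_
    rw [markovPolicyValue_last]
    exact hm.iterValue_le_policyValue hZ hindep hident hg hgc N _ hh

theorem IsMonotone.value_eq (hm : m.IsMonotone) (hZ : ∀ n, Measurable (Z n))
    (hindep : iIndepFun Z P) (hident : ∀ n, IdentDistrib (Z n) (Z 0) P P) {g : ℝ → ℝ}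
    (hg : Monotone g) (hgc : Continuous g) (N : ℕ) {n : ℕ} {h : Hist A n} (hh : m.Feasible h) :
    m.value g P Z N n h = m.iterValue g P (Z 0) (N - n) h.last := by
  apply le_antisymm
  · obtain ⟨π, hπ⟩ := hm.exists_optimal_policy (P := P) (hZ 0) hg hgc N
    refine (iInf_le _ π.toPolicy).trans ?_
    rw [hm.policyValue_eq_iterValue hZ hindep hident hg hgc hπ]
  · exact le_iInf fun π => hm.iterValue_le_policyValue hZ hindep hident hg hgc N π hh

theorem IsMonotone.iSup_iterValue_le_infPolicyValue (hm : m.IsMonotone)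
    (hZ : ∀ n, Measurable (Z n)) (hindep : iIndepFun Z P)
    (hident : ∀ n, IdentDistrib (Z n) (Z 0) P P) {g : ℝ → ℝ} (hg : Monotone g)
    (hgc : Continuous g) (π : m.MarkovPolicy) (y : XState) :
    ⨆ k, m.iterValue g P (Z 0) k y ≤ m.infPolicyValue g P Z π y := by
  rw [infPolicyValue_eq_iSup hg hgc P hZ]
  refine iSup_mono fun N => ?_
  have := congrFun (hm.markovValue_eq hZ hindep hident hg hgc N 0) y
  rw [tsub_zero] at this
  exact this.symm.le.trans (iInf_le _ π)

/-- Under `d` the limit function has constant expectation along the trajectory, and it dominates `g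
s`; so every finite-horizon value of the stationary policy is at most the limit function. -/
theorem IsMonotone.infPolicyValue_stationary (hm : m.IsMonotone)
    (hZ : ∀ n, Measurable (Z n)) (hindep : iIndepFun Z P)
    (hident : ∀ n, IdentDistrib (Z n) (Z 0) P P) {g : ℝ → ℝ} (hg : Monotone g)
    (hgc : Continuous g) {d : m.MarkovRule}
    (hd : m.opRule P (Z 0) d (fun y => ⨆ k, m.iterValue g P (Z 0) k y) =
      fun y => ⨆ k, m.iterValue g P (Z 0) k y) :
    m.infPolicyValue g P Z (fun _ => d) = fun y => ⨆ k, m.iterValue g P (Z 0) k y := by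
  funext y
  refine le_antisymm ?_ (hm.iSup_iterValue_le_infPolicyValue hZ hindep hident hg hgc _ y)
  rw [infPolicyValue_eq_iSup hg hgc P hZ]
  refine iSup_le fun N => ?_
  have hJ := hm.iSup_iterValue_mem P (hZ 0) hg hgc
  have h1 := markovPolicyValue_last g P Z N (fun _ => d : m.MarkovPolicy) (Hist.init A y)
  have h2 := lintegral_history_eq hZ hindep hident (fun _ => d : m.MarkovPolicy) (Hist.init A y)
    (u := fun _ y => ⨆ k, m.iterValue g P (Z 0) k y) (fun _ => hJ.1.measurable) (N - 0)
    fun _ _ => hd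
  rw [policyValue_eq] at h1
  exact h1.le.trans ((lintegral_mono fun ω => hJ.2.2 _).trans h2.le)

theorem IsMonotone.infValue_eq (hm : m.IsMonotone)
    (hZ : ∀ n, Measurable (Z n)) (hindep : iIndepFun Z P)
    (hident : ∀ n, IdentDistrib (Z n) (Z 0) P P) {g : ℝ → ℝ} (hg : Monotone g)
    (hgc : Continuous g) : m.infValue g P Z = fun y => ⨆ k, m.iterValue g P (Z 0) k y := by
  funext y
  refine le_antisymm ?_
    (le_iInf fun π => hm.iSup_iterValue_le_infPolicyValue hZ hindep hident hg hgc π y)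
  obtain ⟨d, hd⟩ := hm.exists_rule P (hZ 0) (hm.iSup_iterValue_mem P (hZ 0) hg hgc)
  rw [hm.bellman_iSup_iterValue P (hZ 0) hg hgc] at hd
  exact (iInf_le _ _).trans
    (congrFun (hm.infPolicyValue_stationary hZ hindep hident hg hgc hd) y).le

end

theorem expectedCost_le_infExpectedCost (P : Measure Ω) (Z : ℕ → Ω → 𝒵) (N : ℕ) (π : m.Policy)
    (x : ℝ) : m.expectedCost P Z N π x ≤ m.infExpectedCost P Z π x := by
  refine lintegral_mono fun ω => ?_
  push_cast
  exact ENNReal.sum_le_tsum _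

end Model

theorem mem_valueFunctions_of_mem_monotoneValueFunctions {g : ℝ → ℝ} {v : XState → ℝ≥0∞}
    (hv : v ∈ monotoneValueFunctions g) : v ∈ valueFunctions g :=
  ⟨hv.1, fun _ _ _ h => hv.2.1 ⟨le_rfl, h⟩, hv.2.2⟩

end RiskMDP

/-! ### The finite and infinite horizon statements combined. -/

theorem proposition6p2 {A 𝒵 Ω : Type*}
    [TopologicalSpace A] [TopologicalSpace.MetrizableSpace A] [SecondCountableTopology A]
    [MeasurableSpace A] [BorelSpace A] [StandardBorelSpace A]
    [MeasurableSpace 𝒵] [MeasurableSpace Ω]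
    (m : RiskMDP.Model A 𝒵) (hm : m.IsMonotone)
    (P : Measure Ω) [IsProbabilityMeasure P]
    (Z : ℕ → Ω → 𝒵) (hZ : ∀ n, Measurable (Z n)) (hindep : iIndepFun Z P)
    (hident : ∀ n, IdentDistrib (Z n) (Z 0) P P)
    (g : ℝ → ℝ) (hg_mono : Monotone g) (hg_conv : ConvexOn ℝ Set.univ g) (hg_nonneg : 0 ≤ g 0) :
    -- finite horizon
    (∀ N : ℕ,
      (∀ n ≤ N,
        -- `V_n` only depends on the current extended state, and agrees with `J_n`
        (∀ h : RiskMDP.Hist A n, m.Feasible h →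
          m.value g P Z N n h = m.markovValue g P Z N n h.last) ∧
        -- `J_n` lies in `𝕄` and is increasing in all variables
        m.markovValue g P Z N n ∈ RiskMDP.valueFunctions g ∧
        Monotone (m.markovValue g P Z N n)) ∧
      -- Bellman equation
      (∀ y, m.markovValue g P Z N N y = ENNReal.ofReal (g y.2.1)) ∧
      (∀ n < N, m.markovValue g P Z N n = m.bellman P (Z 0) (m.markovValue g P Z N (n + 1))) ∧
      -- minimizing Markov decision rules exist, and they constitute an optimal policy
      (∀ n < N, ∃ d : m.MarkovRule,
        m.opRule P (Z 0) d (m.markovValue g P Z N (n + 1)) =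
          m.bellman P (Z 0) (m.markovValue g P Z N (n + 1))) ∧
      (∀ π : m.MarkovPolicy,
        (∀ n < N, m.opRule P (Z 0) (π n) (m.markovValue g P Z N (n + 1)) =
          m.bellman P (Z 0) (m.markovValue g P Z N (n + 1))) →
        ∀ n ≤ N,
          (∀ h : RiskMDP.Hist A n, m.Feasible h →
            m.policyValue g P Z N n (RiskMDP.Model.MarkovPolicy.toPolicy π) h =
              m.value g P Z N n h) ∧
          m.markovPolicyValue g P Z N n π = m.markovValue g P Z N n) ∧
      -- finiteness
      (∀ K : ℝ≥0, LipschitzWith K g → (∀ x, ∃ π : m.Policy, m.expectedCost P Z N π x < ∞) →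
        ∀ n ≤ N, ∀ y, m.markovValue g P Z N n y < ∞)) ∧
    -- infinite horizon: `J_∞` is the smallest fixed point of the Bellman operator and `J_∞ = J`
    (IsLeast {v | v ∈ RiskMDP.valueFunctions g ∧ m.bellman P (Z 0) v = v} (m.infValue g P Z) ∧
      IsLeast {v | v ∈ RiskMDP.monotoneValueFunctions g ∧ m.bellman P (Z 0) v = v}
        (m.infValue g P Z) ∧
      Monotone (m.infValue g P Z) ∧
      (∀ y, Monotone fun N => m.markovValue g P Z N 0 y) ∧
      (∀ y, Tendsto (fun N => m.markovValue g P Z N 0 y) atTop (𝓝 (m.infValue g P Z y))) ∧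
      -- minimizing Markov decision rules exist, and induce optimal stationary policies
      (∃ d : m.MarkovRule, m.opRule P (Z 0) d (m.infValue g P Z) =
        m.bellman P (Z 0) (m.infValue g P Z)) ∧
      (∀ d : m.MarkovRule, m.opRule P (Z 0) d (m.infValue g P Z) =
          m.bellman P (Z 0) (m.infValue g P Z) →
        m.infPolicyValue g P Z (fun _ => d) = m.infValue g P Z) ∧
      -- finiteness
      (∀ K : ℝ≥0, LipschitzWith K g → (∀ x, ∃ π : m.Policy, m.infExpectedCost P Z π x < ∞) →
        ∀ y, m.infValue g P Z y < ∞)) ∧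
    -- the set of potential value functions can be replaced by `𝕄'`
    (∀ v ∈ RiskMDP.monotoneValueFunctions g,
      m.bellman P (Z 0) v ∈ RiskMDP.monotoneValueFunctions g ∧
      ∃ d : m.MarkovRule, m.opRule P (Z 0) d v = m.bellman P (Z 0) v) := by
  have hgc : Continuous g :=
    continuousOn_univ.1 (hg_conv.continuousOn isOpen_univ)
  have hW := hZ 0
  have hmem := hm.iterValue_mem P hW hg_mono hgc
  have hJ : ∀ N n, m.markovValue g P Z N n = m.iterValue g P (Z 0) (N - n) :=
    hm.markovValue_eq hZ hindep hident hg_mono hgc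
  have hInf := hm.infValue_eq hZ hindep hident hg_mono hgc
  have hInf_mem := hm.iSup_iterValue_mem P hW hg_mono hgc
  have hInf_fix := hm.bellman_iSup_iterValue P hW hg_mono hgc
  have hiter := m.iterValue_monotone hg_mono P (Z 0)
  have hfinite : ∀ (K : ℝ≥0) (y : RiskMDP.XState) (C : ℝ≥0∞), C < ∞ →
      ENNReal.ofReal (g 0) + K * (y.2.1 + y.2.2.1 * C) < ∞ := fun K y C hC =>
    ENNReal.add_lt_top.2 ⟨ENNReal.ofReal_lt_top, ENNReal.mul_lt_top ENNReal.coe_lt_top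
      (ENNReal.add_lt_top.2 ⟨ENNReal.coe_lt_top, ENNReal.mul_lt_top ENNReal.coe_lt_top hC⟩)⟩
  have hleast : ∀ v : RiskMDP.XState → ℝ≥0∞, (∀ y, ENNReal.ofReal (g y.2.1) ≤ v y) →
      m.bellman P (Z 0) v = v → (fun y => ⨆ k, m.iterValue g P (Z 0) k y) ≤ v :=
    fun v hv hfix y => iSup_le fun k => RiskMDP.Model.iterValue_le_of_fixed hv hfix k y
  refine ⟨fun N => ⟨fun n hn => ⟨fun h hh => ?_, ?_, ?_⟩, fun y => ?_, fun n hn => ?_,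
    fun n hn => ?_, fun π hπ n hn => ?_, fun K hK hfin n hn y => ?_⟩,
    ⟨⟨⟨?_, ?_⟩, fun v hv => ?_⟩, ⟨⟨?_, ?_⟩, fun v hv => ?_⟩, ?_, fun y => ?_, fun y => ?_,
    ?_, fun d hd => ?_, fun K hK hfin y => ?_⟩,
    fun v hv => ⟨hm.bellman_mem P hW hg_mono hv, hm.exists_rule P hW hv⟩⟩
  · rw [hm.value_eq hZ hindep hident hg_mono hgc N hh, hJ]
  · rw [hJ]
    exact RiskMDP.mem_valueFunctions_of_mem_monotoneValueFunctions (hmem _)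
  · rw [hJ]
    exact (hmem _).2.1
  · rw [hJ, Nat.sub_self]
    rfl
  · rw [hJ, hJ, ← RiskMDP.Model.iterValue_succ, show N - (n + 1) + 1 = N - n by omega]
  · rw [hJ]
    exact hm.exists_rule P hW (hmem _)
  · have hπ' : ∀ k < N, m.opRule P (Z 0) (π k) (m.iterValue g P (Z 0) (N - (k + 1))) =
        m.iterValue g P (Z 0) (N - k) := fun k hk => by
      have := hπ k hk
      rwa [hJ, ← RiskMDP.Model.iterValue_succ, show N - (k + 1) + 1 = N - k by omega] at this
    refine ⟨fun h hh => ?_, ?_⟩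
    · rw [hm.value_eq hZ hindep hident hg_mono hgc N hh,
        hm.policyValue_eq_iterValue hZ hindep hident hg_mono hgc hπ']
    · funext y
      obtain ⟨h, -, rfl⟩ := m.exists_feasible_last n y
      rw [RiskMDP.Model.markovPolicyValue_last, hJ,
        hm.policyValue_eq_iterValue hZ hindep hident hg_mono hgc hπ']
  · obtain ⟨π, hπ⟩ := hfin y.1
    rw [hJ]
    exact (hm.iterValue_le_expectedCost hZ hindep hident hK _ N (Nat.sub_le _ _) π y).trans_lt
      (hfinite K y _ hπ)
  · rw [hInf]
    exact RiskMDP.mem_valueFunctions_of_mem_monotoneValueFunctions hInf_mem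
  · rw [hInf, hInf_fix]
  · rw [hInf]
    exact hleast v hv.1.2.2 hv.2
  · rw [hInf]
    exact hInf_mem
  · rw [hInf, hInf_fix]
  · rw [hInf]
    exact hleast v hv.1.2.2 hv.2
  · rw [hInf]
    exact hInf_mem.2.1
  · simp only [hJ]
    exact fun i j hij => hiter hij y
  · simp only [hJ, hInf]
    exact tendsto_atTop_iSup fun i j hij => hiter hij y
  · rw [hInf]
    exact hm.exists_rule P hW hInf_mem
  · rw [hInf, hInf_fix] at hd
    rw [hInf, hm.infPolicyValue_stationary hZ hindep hident hg_mono hgc hd]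
  · obtain ⟨π, hπ⟩ := hfin y.1
    rw [hInf]
    -- The infinite-horizon cost bounds all iterates uniformly in `k`, hence their supremum.
    refine lt_of_le_of_lt (iSup_le fun k => ?_) (hfinite K y _ hπ)
    refine (hm.iterValue_le_expectedCost hZ hindep hident hK k k le_rfl π y).trans ?_
    gcongr
    exact RiskMDP.Model.expectedCost_le_infExpectedCost P Z k π y.1
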